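/- Let $n,m,T\ge 0$ and $p\ge 1$ be integers. For symmetric matrices, $\geq 0$ and $>0$ mean positive semidefinite and positive definite, $M^\dagger$ is the Moore–Penrose pseudo-inverse, and for a symmetric block matrix $\Pi=\begin{bmatrix}\Pi_{11}&\Pi_{12}\\ \Pi_{21}&\Pi_{22}\end{bmatrix}$ we write $\Pi|\Pi_{22}=\Pi_{11}-\Pi_{12}\Pi_{22}^\dagger\Pi_{21}$. Let data $U_-=[u(0)\,\cdots\,u(T-1)]\in\mathbb R^{m\times T}$, $X=[x(0)\,\cdots\,x(T)]\in\mathbb R^{n\times (T+1)}$, $Y_-=[y(0)\,\cdots\,y(T-1)]\in\mathbb R^{p\times T}$ be given, and put $X_-=[x(0)\,\cdots\,x(T-1)]$, $X_+=[x(1)\,\cdots\,x(T)]$. Let $\Phi=\begin{bmatrix}\Phi_{11}&\Phi_{12}\\ \Phi_{21}&\Phi_{22}\end{bmatrix}$ be a real symmetric matrix of size $(n+p)+T$ with $\Phi_{22}\le 0$, $\Phi|\Phi_{22}\ge 0$ and $\ker\Phi_{22}\subseteq\ker\Phi_{12}$. The set $\Sigma_{\mathcal D}$ of systems consistent with the data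 consists of all quadruples $(A,B,C,D)$ of real matrices of sizes $n\times n$, $n\times m$, $p\times n$, $p\times m$ such that $$V:=\begin{bmatrix}X_+\\Y_-\end{bmatrix}-\begin{bmatrix}A&B\\C&D\end{bmatrix}\begin{bmatrix}X_-\\U_-\end{bmatrix}\quad\text{satisfies}\quad \begin{bmatrix}I\\V^\top\end{bmatrix}^\top\Phi\begin{bmatrix}I\\V^\top\end{bmatrix}\ge 0 .$$ Let $$N=\begin{bmatrix}N_{11}&N_{12}\\N_{12}^\top&N_{22}\end{bmatrix}=L\Phi L^\top,\qquad L=\left[\begin{array}{c|c} I&\begin{matrix}X_+\\Y_-\end{matrix}\\\hline 0&\begin{matrix}-X_-\\-U_-\end{matrix}\end{array}\right],$$ where $N_{11}$ has size $n+p$ and $N_{22}$ has size $n+m$. Let $S\in\mathbb R^{(m+p)\times(m+p)}$ be symmetric. The data are informative for dissipativity with respect to the supply rate $s(u,y)=\begin{bmatrix}u\\y\end{bmatrix}^\top S\begin{bmatrix}u\\y\end{bmatrix}$ if there is a symmetric $P\ge 0$ such that for all $(A,B,C,D)\in\Sigma_{\mathcal D}$ $$\begin{bmatrix}I&0\\A&B\end{bmatrix}^\top\begin{bmatrix}P&0\\0&-P\end{bmatrix}\begin{bmatrix}I&0\\A&B\end{bmatrix}+\begin{bmatrix}0&I\\C&D\end{bmatrix}^\top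 S\begin{bmatrix}0&I\\C&D\end{bmatrix}\ge 0 .$$ **Theorem.** Assume that $S$ has (with multiplicity) $p$ negative, no zero and $m$ positive eigenvalues, and that $N|N_{22}>0$. Partition $-S^{-1}=\begin{bmatrix}\hat F&\hat G\\ \hat G^\top&\hat H\end{bmatrix}$ with $\hat F\in\mathbb R^{m\times m}$, $\hat G\in\mathbb R^{m\times p}$, $\hat H\in\mathbb R^{p\times p}$. Then the data are informative for dissipativity with respect to the supply rate $s$ if and only if there exist a symmetric $Q\in\mathbb R^{n\times n}$, $Q>0$, and a scalar $\alpha\ge 0$ such that $$\begin{bmatrix}Q&0&0&0\\0&\hat H&0&-\hat G^\top\\0&0&-Q&0\\0&-\hat G&0&\hat F\end{bmatrix}-\alpha N\ge 0 .$$ Moreover, for any such $Q$ and $\alpha$, $P:=Q^{-1}$ is a common storage function for all systems consistent with the data: $P\ge 0$, and for every $(A,B,C,D)\in\Sigma_{\mathcal D}$ and all trajectories of $x(t+1)=Ax(t)+Bu(t)$, $y(t)=Cx(t)+Du(t)$ on $t=0,1,2,\dots$, one has $x(t+1)^\top Px(t+1)-x(t)^\top Px(t)\le s(u(t),y(t))$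 for all $t\ge 0$. -/

import Mathlib

open Matrix

namespace DataDissipativity

noncomputable section

/-! ### Matrix notions -/

/-- The inertia of a real symmetric matrix: the numbers of negative, zero and positive eigenvalues,
counted with multiplicity. -/
def inertia {ι : Type*} [Fintype ι] [DecidableEq ι] (S : Matrix ι ι ℝ) : ℕ × ℕ × ℕ :=
  (Multiset.card (S.charpoly.roots.filter (fun x => x < 0)),
   Multiset.card (S.charpoly.roots.filter (fun x => x = 0)),
   Multiset.card (S.charpoly.roots.filter (fun x => 0 < x)))

/-- The four Penrose equations: `X` is the Moore-Penrose pseudo-inverse of the real matrix `A`. -/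
structure IsMoorePenrose {ι κ : Type*} [Fintype ι] [Fintype κ]
    (A : Matrix ι κ ℝ) (X : Matrix κ ι ℝ) : Prop where
  mul_mul_left : A * X * A = A
  mul_mul_right : X * A * X = X
  symm_left : (A * X)ᵀ = A * X
  symm_right : (X * A)ᵀ = X * A

/-- The Moore-Penrose pseudo-inverse of a real matrix `A`, namely `(Aᵀ A)† Aᵀ`, where `(Aᵀ A)†` is
obtained from a spectral decomposition of `Aᵀ A` by inverting the nonzero eigenvalues. -/
def pinv {ι κ : Type*} [Fintype ι] [Fintype κ] [DecidableEq κ] (A : Matrix ι κ ℝ) :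
    Matrix κ ι ℝ :=
  let hA := isHermitian_conjTranspose_mul_self A
  (hA.eigenvectorUnitary : Matrix κ κ ℝ) * diagonal (fun i => (hA.eigenvalues i)⁻¹) *
    (hA.eigenvectorUnitary : Matrix κ κ ℝ)ᵀ * Aᵀ

theorem pinv_isMoorePenrose {ι κ : Type*} [Fintype ι] [Fintype κ] [DecidableEq κ]
    (A : Matrix ι κ ℝ) : IsMoorePenrose A (pinv A) := by
  set hA := isHermitian_conjTranspose_mul_self A with hAdef
  set U : Matrix κ κ ℝ := (hA.eigenvectorUnitary : Matrix κ κ ℝ) with hU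
  set d := hA.eigenvalues with hd
  have hUU : Uᵀ * U = 1 := by
    have := Unitary.coe_star_mul_self hA.eigenvectorUnitary
    rw [star_eq_conjTranspose, conjTranspose_eq_transpose_of_trivial] at this
    exact this
  set H : Matrix κ κ ℝ := U * diagonal (fun i => (d i)⁻¹) * Uᵀ with hH
  have hG : Aᵀ * A = U * diagonal d * Uᵀ := by
    have := hA.spectral_theorem
    rw [Unitary.conjStarAlgAut_apply] at this
    exact this
  have hX : pinv A = H * Aᵀ := rfl
  have hHt : Hᵀ = H := by simp [hH, Matrix.mul_assoc]
  have key : ∀ a b : κ → ℝ, (U * diagonal a * Uᵀ) * (U * diagonal b * Uᵀ)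
      = U * diagonal (fun i => a i * b i) * Uᵀ := by
    intro a b
    calc (U * diagonal a * Uᵀ) * (U * diagonal b * Uᵀ)
        = U * diagonal a * (Uᵀ * U) * diagonal b * Uᵀ := by simp only [Matrix.mul_assoc]
      _ = _ := by rw [hUU, Matrix.mul_one, Matrix.mul_assoc U, diagonal_mul_diagonal]
  have hGHG : Aᵀ * A * H * (Aᵀ * A) = Aᵀ * A := by
    rw [hG, hH, key, key]
    congr; ext i; exact mul_inv_mul_cancel (d i)
  have hHGH : H * (Aᵀ * A) * H = H := by
    rw [hG, hH, key, key]
    congr; ext i; simpa using mul_inv_mul_cancel (d i)⁻¹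
  have hHG : (H * (Aᵀ * A))ᵀ = H * (Aᵀ * A) := by
    rw [hG, hH, key]; simp [Matrix.mul_assoc]
  refine ⟨?_, ?_, ?_, ?_⟩
  · have hz : (A * H * (Aᵀ * A) - A)ᴴ * (A * H * (Aᵀ * A) - A) = 0 := by
      have e : (A * H * (Aᵀ * A) - A)ᴴ = Aᵀ * A * H * Aᵀ - Aᵀ := by
        simp [conjTranspose_eq_transpose_of_trivial, hHt, Matrix.mul_assoc]
      have e2 : Aᵀ * (A * H * (Aᵀ * A) - A) = 0 := by
        rw [Matrix.mul_sub, show Aᵀ * (A * H * (Aᵀ * A)) = Aᵀ * A * H * (Aᵀ * A) by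
          simp only [Matrix.mul_assoc], hGHG, sub_self]
      rw [e, Matrix.sub_mul, Matrix.mul_assoc _ Aᵀ, e2]
      simp
    have := sub_eq_zero.1 (conjTranspose_mul_self_eq_zero.1 hz)
    rw [hX, ← Matrix.mul_assoc, Matrix.mul_assoc]
    exact this
  · rw [hX]
    calc H * Aᵀ * A * (H * Aᵀ) = H * (Aᵀ * A) * H * Aᵀ := by simp only [Matrix.mul_assoc]
      _ = _ := by rw [hHGH]
  · rw [hX]; simp [hHt, Matrix.mul_assoc]
  · rw [hX, Matrix.mul_assoc]; exact hHG

/-- The generalized Schur complement `Π | Π₂₂ = Π₁₁ - Π₁₂ Π₂₂† Π₂₁`. -/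
def schurCompl {q r : Type*} [Fintype q] [Fintype r] [DecidableEq r]
    (M : Matrix (q ⊕ r) (q ⊕ r) ℝ) : Matrix q q ℝ :=
  M.toBlocks₁₁ - M.toBlocks₁₂ * pinv M.toBlocks₂₂ * M.toBlocks₂₁

/-- The solution set of the quadratic matrix inequality `[I; Z]ᵀ Π [I; Z] ≥ 0`. -/
def qmiSet {q r : Type*} [Fintype q] [Fintype r] [DecidableEq q]
    (M : Matrix (q ⊕ r) (q ⊕ r) ℝ) : Set (Matrix r q ℝ) :=
  {Z | let W : Matrix (q ⊕ r) q ℝ := fromRows 1 Z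
    (Wᵀ * M * W).PosSemidef}

/-- The symmetric matrices `Π` with `Π₂₂ ≤ 0`, `Π | Π₂₂ ≥ 0` and `ker Π₂₂ ⊆ ker Π₁₂`. -/
def PiClass (q r : Type*) [Fintype q] [Fintype r] [DecidableEq r] :
    Set (Matrix (q ⊕ r) (q ⊕ r) ℝ) :=
  {M | M.IsSymm ∧ (-M.toBlocks₂₂).PosSemidef ∧ (schurCompl M).PosSemidef ∧
    ∀ v : r → ℝ, M.toBlocks₂₂ *ᵥ v = 0 → M.toBlocks₁₂ *ᵥ v = 0}

/-! ### Systems, supply rates and dissipativity -/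

/-- System matrices of `x(t+1) = A x(t) + B u(t)`, `y(t) = C x(t) + D u(t)`, with input dimension
`m`, state dimension `n` and output dimension `p`. -/
structure LinSys (n m p : ℕ) where
  A : Matrix (Fin n) (Fin n) ℝ
  B : Matrix (Fin n) (Fin m) ℝ
  C : Matrix (Fin p) (Fin n) ℝ
  D : Matrix (Fin p) (Fin m) ℝ

/-- The block matrix `[A B; C D]`. -/
def LinSys.toMatrix {n m p : ℕ} (sys : LinSys n m p) :
    Matrix (Fin n ⊕ Fin p) (Fin n ⊕ Fin m) ℝ :=
  fromBlocks sys.A sys.B sys.C sys.D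

/-- `(u, x, y)` is a (noise-free) trajectory of the system on the nonnegative integers. -/
def LinSys.IsTrajectory {n m p : ℕ} (sys : LinSys n m p)
    (u : ℕ → Fin m → ℝ) (x : ℕ → Fin n → ℝ) (y : ℕ → Fin p → ℝ) : Prop :=
  ∀ t, x (t + 1) = sys.A *ᵥ x t + sys.B *ᵥ u t ∧ y t = sys.C *ᵥ x t + sys.D *ᵥ u t

/-- The supply rate `s(u, y) = [u; y]ᵀ S [u; y]`. -/
def supplyRate {m p : ℕ} (S : Matrix (Fin m ⊕ Fin p) (Fin m ⊕ Fin p) ℝ)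
    (u : Fin m → ℝ) (y : Fin p → ℝ) : ℝ :=
  Sum.elim u y ⬝ᵥ (S *ᵥ Sum.elim u y)

/-- `xᵀ P x` is a storage function: `P ≥ 0` and the dissipation inequality holds along all
trajectories. -/
def LinSys.IsStorage {n m p : ℕ} (sys : LinSys n m p)
    (S : Matrix (Fin m ⊕ Fin p) (Fin m ⊕ Fin p) ℝ) (P : Matrix (Fin n) (Fin n) ℝ) : Prop :=
  P.PosSemidef ∧
    ∀ (u : ℕ → Fin m → ℝ) (x : ℕ → Fin n → ℝ) (y : ℕ → Fin p → ℝ), sys.IsTrajectory u x y →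
      ∀ t, x (t + 1) ⬝ᵥ (P *ᵥ x (t + 1)) - x t ⬝ᵥ (P *ᵥ x t) ≤ supplyRate S (u t) (y t)

/-- The left-hand side of the linear matrix inequality that expresses the dissipation inequality:
`[I 0; A B]ᵀ [P 0; 0 -P] [I 0; A B] + [0 I; C D]ᵀ S [0 I; C D]`. -/
def LinSys.dissipationMatrix {n m p : ℕ} (sys : LinSys n m p)
    (S : Matrix (Fin m ⊕ Fin p) (Fin m ⊕ Fin p) ℝ) (P : Matrix (Fin n) (Fin n) ℝ) :
    Matrix (Fin n ⊕ Fin m) (Fin n ⊕ Fin m) ℝ :=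
  let J : Matrix (Fin n ⊕ Fin n) (Fin n ⊕ Fin m) ℝ := fromBlocks 1 0 sys.A sys.B
  let K : Matrix (Fin m ⊕ Fin p) (Fin n ⊕ Fin m) ℝ := fromBlocks 0 1 sys.C sys.D
  Jᵀ * fromBlocks P 0 0 (-P) * J + Kᵀ * S * K

/-! ### Noisy data -/

/-- Input-state-output data: the columns of `U` are `u(0), …, u(T-1)`, those of `X` are
`x(0), …, x(T)`, and those of `Y` are `y(0), …, y(T-1)`. -/
structure ISOData (n m p T : ℕ) where
  U : Matrix (Fin m) (Fin T) ℝ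
  X : Matrix (Fin n) (Fin (T + 1)) ℝ
  Y : Matrix (Fin p) (Fin T) ℝ

/-- `X₋ = [x(0) ⋯ x(T-1)]`. -/
def ISOData.Xminus {n m p T : ℕ} (𝒟 : ISOData n m p T) : Matrix (Fin n) (Fin T) ℝ :=
  𝒟.X.submatrix id Fin.castSucc

/-- `X₊ = [x(1) ⋯ x(T)]`. -/
def ISOData.Xplus {n m p T : ℕ} (𝒟 : ISOData n m p T) : Matrix (Fin n) (Fin T) ℝ :=
  𝒟.X.submatrix id Fin.succ

/-- The systems consistent with the data: those for which the noise matrix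
`V₋ = [X₊; Y₋] - [A B; C D] [X₋; U₋]` satisfies the noise model `[I; V₋ᵀ]ᵀ Φ [I; V₋ᵀ] ≥ 0`. -/
def consistentSystems {n m p T : ℕ} (𝒟 : ISOData n m p T)
    (Φ : Matrix ((Fin n ⊕ Fin p) ⊕ Fin T) ((Fin n ⊕ Fin p) ⊕ Fin T) ℝ) : Set (LinSys n m p) :=
  {sys | (fromRows 𝒟.Xplus 𝒟.Y - sys.toMatrix * fromRows 𝒟.Xminus 𝒟.U)ᵀ ∈ qmiSet Φ}

/-- The noisy data are informative for dissipativity: one matrix `P ≥ 0` satisfies the dissipation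
inequality for all systems consistent with the data. -/
def InformativeForDissipativity {n m p T : ℕ} (𝒟 : ISOData n m p T)
    (Φ : Matrix ((Fin n ⊕ Fin p) ⊕ Fin T) ((Fin n ⊕ Fin p) ⊕ Fin T) ℝ)
    (S : Matrix (Fin m ⊕ Fin p) (Fin m ⊕ Fin p) ℝ) : Prop :=
  ∃ P : Matrix (Fin n) (Fin n) ℝ, P.PosSemidef ∧
    ∀ sys ∈ consistentSystems 𝒟 Φ, (sys.dissipationMatrix S P).PosSemidef

/-- The matrix `N = L Φ Lᵀ` with `L = [I [X₊; Y₋]; 0 [-X₋; -U₋]]`. -/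
def dataMatrix {n m p T : ℕ} (𝒟 : ISOData n m p T)
    (Φ : Matrix ((Fin n ⊕ Fin p) ⊕ Fin T) ((Fin n ⊕ Fin p) ⊕ Fin T) ℝ) :
    Matrix ((Fin n ⊕ Fin p) ⊕ (Fin n ⊕ Fin m)) ((Fin n ⊕ Fin p) ⊕ (Fin n ⊕ Fin m)) ℝ :=
  let L : Matrix ((Fin n ⊕ Fin p) ⊕ (Fin n ⊕ Fin m)) ((Fin n ⊕ Fin p) ⊕ Fin T) ℝ :=
    fromBlocks 1 (fromRows 𝒟.Xplus 𝒟.Y) 0 (fromRows (-𝒟.Xminus) (-𝒟.U))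
  L * Φ * Lᵀ

/-- With `-S⁻¹ = [F G; Gᵀ H]`, the matrix
`[Q 0 0 0; 0 H 0 -Gᵀ; 0 0 -Q 0; 0 -G 0 F]`. -/
def dualMatrix {n m p : ℕ} (S : Matrix (Fin m ⊕ Fin p) (Fin m ⊕ Fin p) ℝ)
    (Q : Matrix (Fin n) (Fin n) ℝ) :
    Matrix ((Fin n ⊕ Fin p) ⊕ (Fin n ⊕ Fin m)) ((Fin n ⊕ Fin p) ⊕ (Fin n ⊕ Fin m)) ℝ :=
  let F := (-S⁻¹).toBlocks₁₁
  let G := (-S⁻¹).toBlocks₁₂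
  let H := (-S⁻¹).toBlocks₂₂
  fromBlocks (fromBlocks Q 0 0 H) (fromBlocks 0 0 0 (-Gᵀ))
    (fromBlocks 0 0 0 (-G)) (fromBlocks (-Q) 0 0 F)

end

end DataDissipativity
open DataDissipativity

/-! Put `Z = [A B; C D]ᵀ`. Consistency with the data is a quadratic matrix inequality in `Z` with
matrix `N`. For `P > 0` the dissipation inequality says that `Ψ = diag(P, -P, S)` is nonnegative on
the graph of the system, of dimension `n + m`. The inertia of `S` makes this the largest dimension
of a nonnegative subspace of `Ψ`, so the inequality is equivalent to `Ψ⁻¹` being nonpositive on the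
orthogonal complement (`quadForm_inv_nonpos_of_orthogonal`, used in both directions). That
complement is parametrized by `Z`, which gives a quadratic matrix inequality with `dualMatrix S
P⁻¹`.

Informativity is thus an inclusion of two solution sets. Since `N | N₂₂ > 0`, every `(x, y)` with `x
≠ 0` and nonnegative `N`-value has `y = Z x` for some solution `Z`. The inclusion therefore becomes
an implication between scalar quadratic forms, and the S-lemma supplies `α`.

It remains to show that a common `P ≥ 0` is positive definite. If `xᵀ P x = 0` with `x ≠ 0`, some
consistent system has `C x ≠ 0`. Then `S` is nonnegative on the `m + 1` dimensional space of vectors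
`(u, τ C x + D u)`, against its `p` negative eigenvalues. -/

namespace DataDissipativity

/-! ### Quadratic forms of real matrices -/

/-- The quadratic form `xᵀ M x`. -/
def quadForm {ι : Type*} [Fintype ι] (M : Matrix ι ι ℝ) (x : ι → ℝ) : ℝ :=
  x ⬝ᵥ (M *ᵥ x)

section QuadForm

variable {ι κ : Type*} [Fintype ι] [Fintype κ]

theorem posSemidef_iff_quadForm {M : Matrix ι ι ℝ} :
    M.PosSemidef ↔ M.IsSymm ∧ ∀ x, 0 ≤ quadForm M x := by
  rw [posSemidef_iff_dotProduct_mulVec]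
  simp [IsHermitian, IsSymm, quadForm, conjTranspose_eq_transpose_of_trivial]

theorem posDef_iff_quadForm {M : Matrix ι ι ℝ} :
    M.PosDef ↔ M.IsSymm ∧ ∀ x, x ≠ 0 → 0 < quadForm M x := by
  rw [posDef_iff_dotProduct_mulVec]
  simp [IsHermitian, IsSymm, quadForm, conjTranspose_eq_transpose_of_trivial]

theorem quadForm_conj (M : Matrix ι ι ℝ) (B : Matrix ι κ ℝ) (x : κ → ℝ) :
    quadForm (Bᵀ * M * B) x = quadForm M (B *ᵥ x) := by
  simp only [quadForm, ← mulVec_mulVec]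
  rw [dotProduct_mulVec, vecMul_transpose]

omit [Fintype κ] in
theorem isSymm_transpose_mul_mul_same {M : Matrix ι ι ℝ} (hM : M.IsSymm) (B : Matrix ι κ ℝ) :
    (Bᵀ * M * B).IsSymm := by
  simp [IsSymm, hM.eq, Matrix.mul_assoc]

theorem dotProduct_mulVec_comm {M : Matrix ι ι ℝ} (hM : M.IsSymm) (x y : ι → ℝ) :
    x ⬝ᵥ (M *ᵥ y) = y ⬝ᵥ (M *ᵥ x) := by
  rw [dotProduct_mulVec, ← mulVec_transpose, hM.eq, dotProduct_comm]

theorem quadForm_smul_add_smul {M : Matrix ι ι ℝ} (hM : M.IsSymm) (a b : ℝ) (x y : ι → ℝ) :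
    quadForm M (a • x + b • y) =
      a ^ 2 * quadForm M x + 2 * a * b * (x ⬝ᵥ (M *ᵥ y)) + b ^ 2 * quadForm M y := by
  simp only [quadForm, mulVec_add, mulVec_smul, add_dotProduct, dotProduct_add, smul_dotProduct,
    dotProduct_smul, smul_eq_mul, dotProduct_mulVec_comm hM y x]
  ring

theorem quadForm_smul (M : Matrix ι ι ℝ) (a : ℝ) (x : ι → ℝ) :
    quadForm M (a • x) = a ^ 2 * quadForm M x := by
  simp only [quadForm, mulVec_smul, smul_dotProduct, dotProduct_smul, smul_eq_mul]
  ring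

@[simp] theorem quadForm_zero (M : Matrix ι ι ℝ) : quadForm M 0 = 0 := by
  simp [quadForm]

@[simp] theorem quadForm_neg (M : Matrix ι ι ℝ) (x : ι → ℝ) :
    quadForm (-M) x = -quadForm M x := by
  simp [quadForm, neg_mulVec]

theorem quadForm_add (M N : Matrix ι ι ℝ) (x : ι → ℝ) :
    quadForm (M + N) x = quadForm M x + quadForm N x := by
  simp [quadForm, add_mulVec]

theorem quadForm_sub_smul (M N : Matrix ι ι ℝ) (a : ℝ) (x : ι → ℝ) :
    quadForm (M - a • N) x = quadForm M x - a * quadForm N x := by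
  simp [quadForm, sub_mulVec, smul_mulVec]

theorem quadForm_fromBlocks_diag (M : Matrix ι ι ℝ) (N : Matrix κ κ ℝ) (x : ι → ℝ) (y : κ → ℝ) :
    quadForm (fromBlocks M 0 0 N) (Sum.elim x y) = quadForm M x + quadForm N y := by
  simp [quadForm, fromBlocks_mulVec]

theorem continuous_quadForm (M : Matrix ι ι ℝ) : Continuous (quadForm M) := by
  unfold quadForm
  fun_prop

theorem mulVec_eq_zero_of_quadForm_eq_zero {M : Matrix ι ι ℝ} (hM : M.PosSemidef) {x : ι → ℝ}
    (hx : quadForm M x = 0) : M *ᵥ x = 0 := by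
  classical
  exact (hM.dotProduct_mulVec_zero_iff x).1 (by simpa [quadForm] using hx)

/-! ### The S-lemma -/

/-- In the plane of `x` and `y` the form `N` is indefinite, so it has two isotropic lines. `M` is
nonnegative on both, and a positive combination of the two inequalities eliminates the mixed term of
`M`. -/
theorem mul_quadForm_le_of_neg_of_pos {M N : Matrix ι ι ℝ} (hM : M.IsSymm) (hN : N.IsSymm)
    (h : ∀ x, 0 ≤ quadForm N x → 0 ≤ quadForm M x) {x y : ι → ℝ}
    (hx : 0 < quadForm N x) (hy : quadForm N y < 0) :
    quadForm N y * quadForm M x ≤ quadForm N x * quadForm M y := by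
  set a := quadForm N x with ha
  set d := quadForm N y with hd
  set b := x ⬝ᵥ (N *ᵥ y) with hb
  obtain ⟨t, ht⟩ : ∃ t : ℝ, a + 2 * t * b + t ^ 2 * d = 0 := by
    have hnn : 0 ≤ b ^ 2 - a * d := by nlinarith [sq_nonneg b]
    refine ⟨(-b + √(b ^ 2 - a * d)) / d, ?_⟩
    have hs := Real.sq_sqrt hnn
    have hd0 : d ≠ 0 := hy.ne
    field_simp
    linear_combination hs
  have h1 := h ((1 : ℝ) • x + t • y) (by
    rw [quadForm_smul_add_smul hN, ← ha, ← hd, ← hb]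
    linarith)
  -- The other isotropic line: the two roots have product `a / d`, and the vector is scaled by `t *
  -- d` to avoid division.
  have h2 := h ((t * d) • x + a • y) (by
    rw [quadForm_smul_add_smul hN, ← ha, ← hd, ← hb]
    have : (t * d) ^ 2 * a + 2 * (t * d) * a * b + a ^ 2 * d = 0 := by
      linear_combination a * d * ht
    exact this.ge)
  rw [quadForm_smul_add_smul hM] at h1 h2
  have h3 : t ^ 2 * d - a < 0 := by nlinarith [sq_nonneg t]
  have h4 : 0 ≤ (t ^ 2 * d - a) * (d * quadForm M x - a * quadForm M y) := by
    nlinarith [mul_nonneg (mul_pos (neg_pos.2 hy) hx).le h1]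
  by_contra hcon
  nlinarith

/-- The homogeneous S-lemma. -/
theorem exists_smul_quadForm_le {M N : Matrix ι ι ℝ} (hM : M.IsSymm) (hN : N.IsSymm)
    (h : ∀ x, 0 ≤ quadForm N x → 0 ≤ quadForm M x) (hpos : ∃ x, 0 < quadForm N x) :
    ∃ α : ℝ, 0 ≤ α ∧ ∀ x, α * quadForm N x ≤ quadForm M x := by
  set s : Set ℝ := {r | ∃ x, 0 < quadForm N x ∧ r = quadForm M x / quadForm N x} with hs
  have hs0 : ∀ r ∈ s, 0 ≤ r := by
    rintro r ⟨x, hx, rfl⟩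
    exact div_nonneg (h x hx.le) hx.le
  have hne : s.Nonempty := hpos.imp' (fun x => quadForm M x / quadForm N x) fun x hx => ⟨x, hx, rfl⟩
  -- The infimum is the largest multiplier allowed where `N > 0`. By the preceding lemma, every
  -- ratio taken where `N < 0` is a lower bound of `s`, so those points are satisfied too.
  refine ⟨sInf s, Real.sInf_nonneg hs0, fun y => ?_⟩
  rcases lt_trichotomy (quadForm N y) 0 with hy | hy | hy
  · have : quadForm M y / quadForm N y ≤ sInf s := by
      refine le_csInf hne ?_
      rintro r ⟨x, hx, rfl⟩
      rw [le_div_iff₀ hx, div_mul_eq_mul_div, div_le_iff_of_neg hy]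
      linarith [mul_quadForm_le_of_neg_of_pos hM hN h hx hy]
    rwa [div_le_iff_of_neg hy] at this
  · simpa [hy] using h y hy.ge
  · rw [← le_div_iff₀ hy]
    exact csInf_le ⟨0, hs0⟩ ⟨y, hy, rfl⟩

/-! ### Inertia and dualization -/

/-- A subspace on which a form is nonnegative has at most the complementary dimension of one on
which it is negative definite. -/
theorem exists_ne_zero_map_eq_zero {E : Type*} [AddCommGroup E] [Module ℝ E]
    [FiniteDimensional ℝ E] {Ψ : Matrix ι ι ℝ} {K : Matrix ι κ ℝ}
    (hK : ∀ c, c ≠ 0 → quadForm Ψ (K *ᵥ c) < 0) (f : E →ₗ[ℝ] ι → ℝ)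
    (hf : ∀ a, 0 ≤ quadForm Ψ (f a))
    (hcard : Fintype.card ι < Module.finrank ℝ E + Fintype.card κ) :
    ∃ a, a ≠ 0 ∧ f a = 0 := by
  have hker : LinearMap.ker (f.coprod (-K.mulVecLin)) ≠ ⊥ :=
    LinearMap.ker_ne_bot_of_finrank_lt (by simpa using hcard)
  obtain ⟨⟨a, c⟩, hac, hne⟩ := (Submodule.ne_bot_iff _).1 hker
  have hfa : f a = K *ᵥ c := by
    simpa [add_neg_eq_zero] using hac
  have hc : c = 0 := by
    by_contra hc
    exact absurd (hf a) (not_le.2 (hfa ▸ hK c hc))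
  subst hc
  refine ⟨a, fun h => hne (by simp [h]), by simpa using hfa⟩

/-- Dualization: if a nondegenerate form is nonnegative on a subspace of maximal dimension, then
the inverse form is nonpositive on the orthogonal complement. -/
theorem quadForm_inv_nonpos_of_orthogonal [DecidableEq ι] {E : Type*} [AddCommGroup E] [Module ℝ E]
    [FiniteDimensional ℝ E] {Ψ Θ : Matrix ι ι ℝ} (hΨ : Ψ.IsSymm) (hΨΘ : Ψ * Θ = 1)
    {K : Matrix ι κ ℝ} (hK : ∀ c, c ≠ 0 → quadForm Ψ (K *ᵥ c) < 0) (f : E →ₗ[ℝ] ι → ℝ)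
    (hinj : ∀ a, f a = 0 → a = 0) (hf : ∀ a, 0 ≤ quadForm Ψ (f a))
    (hcard : Fintype.card ι ≤ Module.finrank ℝ E + Fintype.card κ)
    {w : ι → ℝ} (hw : ∀ a, f a ⬝ᵥ w = 0) : quadForm Θ w ≤ 0 := by
  by_contra! hpos
  -- `v` is `Ψ`-orthogonal to the range of `f` and has positive `Ψ`-value, so adjoining it gives a
  -- nonnegative subspace that is one dimension too large.
  set v := Θ *ᵥ w with hv
  have hΨv : Ψ *ᵥ v = w := by rw [hv, mulVec_mulVec, hΨΘ, one_mulVec]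
  have hqv : 0 < quadForm Ψ v := by
    rw [quadForm, hΨv, dotProduct_comm]
    exact hpos
  have hsum : ∀ a t, quadForm Ψ (f a + t • v) = quadForm Ψ (f a) + t ^ 2 * quadForm Ψ v := by
    intro a t
    have := quadForm_smul_add_smul hΨ 1 t (f a) v
    rw [hΨv, hw a] at this
    simpa using this
  obtain ⟨⟨a, t⟩, hne, h0⟩ := exists_ne_zero_map_eq_zero (E := E × ℝ) hK
    (f.coprod (LinearMap.toSpanSingleton ℝ _ v))
    (by
      rintro ⟨a, t⟩
      simp only [LinearMap.coprod_apply, LinearMap.toSpanSingleton_apply, hsum]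
      have := hf a
      positivity)
    (by simp; omega)
  simp only [LinearMap.coprod_apply, LinearMap.toSpanSingleton_apply] at h0
  have h1 := hsum a t
  rw [h0, quadForm_zero] at h1
  have ht : t = 0 := by
    by_contra ht
    have : 0 < t ^ 2 * quadForm Ψ v := by positivity
    linarith [hf a]
  subst ht
  exact hne (by simp [hinj a (by simpa using h0)])

/-- The eigenvectors of a symmetric matrix for the eigenvalues in a given set. -/
theorem exists_transpose_mul_mul_eq_diagonal [DecidableEq ι] {S : Matrix ι ι ℝ} (hS : S.IsSymm)
    (r : ℝ → Prop) [DecidablePred r] {k : ℕ}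
    (hk : Multiset.card (S.charpoly.roots.filter r) = k) :
    ∃ (K : Matrix ι (Fin k) ℝ) (d : Fin k → ℝ),
      (∀ i, r (d i)) ∧ Kᵀ * S * K = diagonal d := by
  have hH : S.IsHermitian := by
    rw [IsHermitian, conjTranspose_eq_transpose_of_trivial, hS.eq]
  have hcard : k = Fintype.card {i // r (hH.eigenvalues i)} := by
    rw [← hk, hH.roots_charpoly_eq_eigenvalues, Fintype.card_subtype, Multiset.filter_map,
      Multiset.card_map]
    rfl
  let e := (Fintype.equivFinOfCardEq hcard.symm).symm
  set U : Matrix ι ι ℝ := (hH.eigenvectorUnitary : Matrix ι ι ℝ) with hU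
  have hUU : Uᵀ * U = 1 := by
    have := Unitary.coe_star_mul_self hH.eigenvectorUnitary
    rwa [star_eq_conjTranspose, conjTranspose_eq_transpose_of_trivial] at this
  have hSU : S = U * diagonal hH.eigenvalues * Uᵀ := by
    have := hH.spectral_theorem
    rw [Unitary.conjStarAlgAut_apply] at this
    exact this
  have hD : Uᵀ * S * U = diagonal hH.eigenvalues := by
    calc Uᵀ * S * U = Uᵀ * (U * diagonal hH.eigenvalues * Uᵀ) * U := by rw [← hSU]
      _ = (Uᵀ * U) * diagonal hH.eigenvalues * (Uᵀ * U) := by simp only [Matrix.mul_assoc]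
      _ = _ := by rw [hUU, Matrix.one_mul, Matrix.mul_one]
  refine ⟨U.submatrix id (fun i => (e i : ι)), fun i => hH.eigenvalues (e i),
    fun i => (e i).2, ?_⟩
  have : (U.submatrix id (fun i => (e i : ι)))ᵀ * S * U.submatrix id (fun i => (e i : ι)) =
      (Uᵀ * S * U).submatrix (fun i => (e i : ι)) (fun i => (e i : ι)) := by
    ext i j
    simp [Matrix.mul_apply]
  rw [this, hD]
  exact submatrix_diagonal _ _ (Subtype.val_injective.comp e.injective)

theorem quadForm_diagonal [DecidableEq ι] (d c : ι → ℝ) :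
    quadForm (diagonal d) c = ∑ i, d i * c i ^ 2 := by
  simp only [quadForm, mulVec_diagonal, dotProduct]
  exact Finset.sum_congr rfl fun i _ => by ring

theorem quadForm_diagonal_pos [DecidableEq ι] {d c : ι → ℝ} (hd : ∀ i, 0 < d i) (hc : c ≠ 0) :
    0 < quadForm (diagonal d) c := by
  rw [quadForm_diagonal]
  obtain ⟨i, hi⟩ := Function.ne_iff.1 hc
  refine Finset.sum_pos' (fun j _ => mul_nonneg (hd j).le (sq_nonneg _)) ⟨i, Finset.mem_univ i, ?_⟩
  have : c i ≠ 0 := hi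
  have := hd i
  positivity

theorem exists_matrix_quadForm_neg [DecidableEq ι] {S : Matrix ι ι ℝ} (hS : S.IsSymm)
    {a b c : ℕ} (hIn : inertia S = (a, b, c)) :
    ∃ K : Matrix ι (Fin a) ℝ, ∀ x, x ≠ 0 → quadForm S (K *ᵥ x) < 0 := by
  obtain ⟨K, d, hd, hK⟩ :=
    exists_transpose_mul_mul_eq_diagonal hS (fun x => x < 0) (congrArg Prod.fst hIn)
  refine ⟨K, fun x hx => ?_⟩
  have := quadForm_diagonal_pos (d := -d) (fun i => neg_pos.2 (hd i)) hx
  rw [← quadForm_conj, hK, ← neg_pos, ← quadForm_neg, diagonal_neg]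
  exact this

theorem exists_matrix_quadForm_pos [DecidableEq ι] {S : Matrix ι ι ℝ} (hS : S.IsSymm)
    {a b c : ℕ} (hIn : inertia S = (a, b, c)) :
    ∃ K : Matrix ι (Fin c) ℝ, ∀ x, x ≠ 0 → 0 < quadForm S (K *ᵥ x) := by
  obtain ⟨K, d, hd, hK⟩ :=
    exists_transpose_mul_mul_eq_diagonal hS (fun x => 0 < x) (congrArg (fun t => t.2.2) hIn)
  refine ⟨K, fun x hx => ?_⟩
  rw [← quadForm_conj, hK]
  exact quadForm_diagonal_pos hd hx

theorem isUnit_det_of_inertia [DecidableEq ι] {S : Matrix ι ι ℝ} {a c : ℕ}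
    (hIn : inertia S = (a, 0, c)) : IsUnit S.det := by
  have h0 : Multiset.card (S.charpoly.roots.filter (fun x => x = 0)) = 0 :=
    congrArg (fun t => t.2.1) hIn
  rw [isUnit_iff_ne_zero]
  intro hdet
  have hmem : (0 : ℝ) ∈ S.charpoly.roots := by
    rw [Polynomial.mem_roots S.charpoly_monic.ne_zero, Polynomial.IsRoot, eval_charpoly]
    simp [det_neg, hdet]
  rw [Multiset.card_eq_zero] at h0
  have hfil := Multiset.mem_filter (p := fun x : ℝ => x = 0).2 ⟨hmem, rfl⟩
  rw [h0] at hfil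
  exact Multiset.notMem_zero _ hfil

end QuadForm

/-! ### Quadratic matrix inequalities -/

section QMI

variable {q r : Type*} [Fintype q] [Fintype r] [DecidableEq q]

theorem mem_qmiSet_iff {M : Matrix (q ⊕ r) (q ⊕ r) ℝ} (hM : M.IsSymm) {Z : Matrix r q ℝ} :
    Z ∈ qmiSet M ↔ ∀ ξ, 0 ≤ quadForm M (Sum.elim ξ (Z *ᵥ ξ)) := by
  set W : Matrix (q ⊕ r) q ℝ := fromRows 1 Z with hW
  change (Wᵀ * M * W).PosSemidef ↔ _
  rw [posSemidef_iff_quadForm, and_iff_right (isSymm_transpose_mul_mul_same hM W)]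
  simp [quadForm_conj, hW, fromRows_mulVec]

variable [DecidableEq r]

omit [DecidableEq q] in
/-- Completion of the square in a block quadratic form with `ker N₂₂ ⊆ ker N₁₂`. -/
theorem exists_quadForm_eq_schurCompl_add {N : Matrix (q ⊕ r) (q ⊕ r) ℝ} (hN : N.IsSymm)
    (hker : ∀ v : r → ℝ, N.toBlocks₂₂ *ᵥ v = 0 → N.toBlocks₁₂ *ᵥ v = 0) :
    ∃ K : Matrix r q ℝ, ∀ x y, quadForm N (Sum.elim x y) =
      quadForm (schurCompl N) x + quadForm N.toBlocks₂₂ (y + K *ᵥ x) := by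
  obtain ⟨N₁₁, B, C, A, rfl⟩ : ∃ N₁₁ B C A, N = fromBlocks N₁₁ B C A :=
    ⟨_, _, _, _, (fromBlocks_toBlocks N).symm⟩
  obtain ⟨-, h21, -, h22⟩ := isSymm_fromBlocks_iff.1 hN
  simp only [schurCompl, toBlocks_fromBlocks₂₂, toBlocks_fromBlocks₁₂, toBlocks_fromBlocks₂₁,
    toBlocks_fromBlocks₁₁] at hker ⊢
  have hp := (pinv_isMoorePenrose A).mul_mul_left
  generalize pinv A = R at hp ⊢
  -- `A` kills the columns of `1 - R * A`, hence so does `B` by the kernel inclusion.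
  have hBR : B * R * A = B := by
    have h0 : A * (1 - R * A) = 0 := by
      rw [Matrix.mul_sub, ← Matrix.mul_assoc, hp, Matrix.mul_one, sub_self]
    have h1 : B * (1 - R * A) = 0 := by
      refine Matrix.ext_of_mulVec_single fun i => ?_
      rw [← mulVec_mulVec, zero_mulVec]
      exact hker _ (by rw [mulVec_mulVec, h0, zero_mulVec])
    rw [Matrix.mul_sub, Matrix.mul_one, ← Matrix.mul_assoc, sub_eq_zero] at h1
    exact h1.symm
  obtain ⟨K, hKA⟩ : ∃ K : Matrix r q ℝ, Kᵀ * A = B := ⟨(B * R)ᵀ, by simpa using hBR⟩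
  have hAK : A * K = C := by rw [← h21, ← hKA, transpose_mul, transpose_transpose, h22.eq]
  have hschur : B * R * C = Kᵀ * A * K := by
    rw [← hAK, ← Matrix.mul_assoc, hBR, hKA]
  refine ⟨K, fun x y => ?_⟩
  have hsq := quadForm_smul_add_smul h22 1 1 y (K *ᵥ x)
  rw [one_smul, one_smul] at hsq
  have hs := quadForm_sub_smul N₁₁ (Kᵀ * A * K) 1 x
  rw [one_smul, one_mul, quadForm_conj] at hs
  have hcross : x ⬝ᵥ (B *ᵥ y) = y ⬝ᵥ (C *ᵥ x) := by
    rw [dotProduct_mulVec, ← mulVec_transpose, dotProduct_comm, h21]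
  rw [hschur, hsq, hs, mulVec_mulVec, hAK]
  simp only [quadForm, fromBlocks_mulVec, Sum.elim_comp_inl, Sum.elim_comp_inr,
    sumElim_dotProduct_sumElim, dotProduct_add, hcross]
  ring

/-- Every vector with nonzero first component at which the form is nonnegative lies on the graph of
a solution of the quadratic matrix inequality. -/
theorem exists_mem_qmiSet_mulVec_eq {N : Matrix (q ⊕ r) (q ⊕ r) ℝ} (hN : N.IsSymm)
    (hker : ∀ v : r → ℝ, N.toBlocks₂₂ *ᵥ v = 0 → N.toBlocks₁₂ *ᵥ v = 0)
    (hS : (schurCompl N).PosDef) {x : q → ℝ} (hx : x ≠ 0) {y : r → ℝ}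
    (hxy : 0 ≤ quadForm N (Sum.elim x y)) : ∃ Z ∈ qmiSet N, Z *ᵥ x = y := by
  obtain ⟨K, hK⟩ := exists_quadForm_eq_schurCompl_add hN hker
  set S := schurCompl N with hSdef
  have hSsymm := (posDef_iff_quadForm.1 hS).1
  have hpos := (posDef_iff_quadForm.1 hS).2 x hx
  set a := quadForm S x with ha
  set w := y + K *ᵥ x with hw
  -- A rank-one perturbation of the center `-K`, chosen to send `x` to `y`.
  have hZ : ∀ ξ, (vecMulVec w (a⁻¹ • S *ᵥ x) - K) *ᵥ ξ
      = (a⁻¹ * (ξ ⬝ᵥ (S *ᵥ x))) • w - K *ᵥ ξ := by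
    intro ξ
    rw [sub_mulVec, vecMulVec_mulVec]
    congr 1
    ext i
    simp [dotProduct_comm]
    ring
  refine ⟨vecMulVec w (a⁻¹ • S *ᵥ x) - K, (mem_qmiSet_iff hN).2 fun ξ => ?_, ?_⟩
  · rw [hZ, hK, sub_add_cancel, quadForm_smul]
    rw [hK] at hxy
    set b := ξ ⬝ᵥ (S *ᵥ x) with hb
    -- Cauchy–Schwarz for `S`. The value at `ξ` is `S(ξ) + (b/a)² N₂₂(w)`, and `hxy` gives `N₂₂(w) ≥
    -- -a`, so it is at least `S(ξ) - b²/a`.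
    have h1 : 0 ≤ quadForm S ((1 : ℝ) • ξ + (-(a⁻¹ * b)) • x) :=
      (posSemidef_iff_quadForm.1 hS.posSemidef).2 _
    rw [quadForm_smul_add_smul hSsymm, ← hb, ← ha] at h1
    have h2 : (a⁻¹ * b) ^ 2 * a = (a⁻¹ * b) * b := by
      field_simp
    nlinarith [mul_nonneg (sq_nonneg (a⁻¹ * b)) hxy]
  · rw [hZ, show x ⬝ᵥ (S *ᵥ x) = a from rfl, inv_mul_cancel₀ hpos.ne', one_smul, hw,
      add_sub_cancel_right]

/-- The matrix S-lemma: inclusion of the solution sets of two quadratic matrix inequalities. -/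
theorem exists_sub_smul_posSemidef_of_qmiSet_subset [Nonempty q]
    {M N : Matrix (q ⊕ r) (q ⊕ r) ℝ} (hM : M.IsSymm) (hN : N.IsSymm)
    (hker : ∀ v : r → ℝ, N.toBlocks₂₂ *ᵥ v = 0 → N.toBlocks₁₂ *ᵥ v = 0)
    (hS : (schurCompl N).PosDef) (hsub : qmiSet N ⊆ qmiSet M) :
    ∃ α : ℝ, 0 ≤ α ∧ (M - α • N).PosSemidef := by
  obtain ⟨K, hK⟩ := exists_quadForm_eq_schurCompl_add hN hker
  have hne : ∀ x y, x ≠ 0 → 0 ≤ quadForm N (Sum.elim x y) → 0 ≤ quadForm M (Sum.elim x y) := by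
    intro x y hx hxy
    obtain ⟨Z, hZ, rfl⟩ := exists_mem_qmiSet_mulVec_eq hN hker hS hx hxy
    exact (mem_qmiSet_iff hM).1 (hsub hZ) x
  obtain ⟨x₀, hx₀⟩ := exists_ne (0 : q → ℝ)
  have hSx₀ := (posDef_iff_quadForm.1 hS).2 x₀ hx₀
  have himp : ∀ z, 0 ≤ quadForm N z → 0 ≤ quadForm M z := by
    intro z hz
    obtain ⟨x, y, rfl⟩ : ∃ x y, z = Sum.elim x y :=
      ⟨z ∘ Sum.inl, z ∘ Sum.inr, (Sum.elim_comp_inl_inr z).symm⟩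
    by_cases hx : x = 0
    · subst hx
      rw [hK, quadForm_zero, mulVec_zero, add_zero, zero_add] at hz
      -- Vectors `(0, y)` with `y ≠ 0` lie on no graph. They are limits of vectors with first
      -- component `ε • x₀`, whose `N`-value `ε² S(x₀) + N₂₂(y)` remains nonnegative.
      have hlim : Filter.Tendsto
          (fun ε : ℝ => quadForm M (Sum.elim (ε • x₀) (y - K *ᵥ (ε • x₀))))
          (nhdsWithin 0 {0}ᶜ) (nhds (quadForm M (Sum.elim 0 y))) := by
        have hc : Continuous
            (fun ε : ℝ => quadForm M (Sum.elim (ε • x₀) (y - K *ᵥ (ε • x₀)))) := by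
          refine (continuous_quadForm M).comp (continuous_pi fun i => ?_)
          rcases i with i | i <;> simp only [Sum.elim_inl, Sum.elim_inr] <;>
            simp only [mulVec_smul, Pi.sub_apply, Pi.smul_apply] <;> fun_prop
        have := hc.tendsto 0
        simp only [zero_smul, mulVec_zero, sub_zero] at this
        exact this.mono_left nhdsWithin_le_nhds
      refine ge_of_tendsto hlim ?_
      filter_upwards [self_mem_nhdsWithin] with ε hε
      refine hne _ _ (smul_ne_zero hε hx₀) ?_
      rw [hK, sub_add_cancel, quadForm_smul]
      positivity
    · exact hne x y hx hz
  obtain ⟨α, hα, h⟩ := exists_smul_quadForm_le hM hN himp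
    ⟨Sum.elim x₀ (-(K *ᵥ x₀)), by rw [hK]; simpa using hSx₀⟩
  refine ⟨α, hα, posSemidef_iff_quadForm.2 ⟨?_, fun x => ?_⟩⟩
  · exact hM.sub (hN.smul α)
  · rw [quadForm_sub_smul]
    linarith [h x]

end QMI

/-! ### The data matrix -/

section Data

variable {n m p T : ℕ}

theorem isSymm_dataMatrix (𝒟 : ISOData n m p T)
    {Φ : Matrix ((Fin n ⊕ Fin p) ⊕ Fin T) ((Fin n ⊕ Fin p) ⊕ Fin T) ℝ} (hΦ : Φ.IsSymm) :
    (dataMatrix 𝒟 Φ).IsSymm := by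
  simp [IsSymm, dataMatrix, hΦ.eq, Matrix.mul_assoc]

/-- With `W` and `E` the right-hand blocks of `L`, `N₂₂ = E Φ₂₂ Eᵀ` and `N₁₂ = (Φ₁₂ + W Φ₂₂) Eᵀ`.
Semidefiniteness of `-Φ₂₂` turns `N₂₂ v = 0` into `Φ₂₂ Eᵀ v = 0`, and the kernel condition on `Φ`
does the rest. -/
theorem ker_dataMatrix (𝒟 : ISOData n m p T)
    {Φ : Matrix ((Fin n ⊕ Fin p) ⊕ Fin T) ((Fin n ⊕ Fin p) ⊕ Fin T) ℝ}
    (hΦ : Φ ∈ PiClass (Fin n ⊕ Fin p) (Fin T)) (v : Fin n ⊕ Fin m → ℝ)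
    (hv : (dataMatrix 𝒟 Φ).toBlocks₂₂ *ᵥ v = 0) : (dataMatrix 𝒟 Φ).toBlocks₁₂ *ᵥ v = 0 := by
  obtain ⟨-, h22, -, hker⟩ := hΦ
  obtain ⟨Φ₁₁, Φ₁₂, Φ₂₁, Φ₂₂, rfl⟩ : ∃ a b c d, Φ = fromBlocks a b c d :=
    ⟨_, _, _, _, (fromBlocks_toBlocks Φ).symm⟩
  simp only [toBlocks_fromBlocks₂₂, toBlocks_fromBlocks₁₂] at h22 hker
  simp only [dataMatrix] at hv ⊢
  generalize fromRows 𝒟.Xplus 𝒟.Y = W at hv ⊢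
  generalize fromRows (-𝒟.Xminus) (-𝒟.U) = E at hv ⊢
  simp only [fromBlocks_transpose, fromBlocks_multiply, toBlocks_fromBlocks₂₂,
    toBlocks_fromBlocks₁₂, transpose_zero, Matrix.zero_mul, Matrix.mul_zero, zero_add,
    Matrix.one_mul] at hv ⊢
  have h0 : quadForm (-Φ₂₂) (Eᵀ *ᵥ v) = 0 := by
    have h := congrArg (fun z => v ⬝ᵥ z) hv
    have h' := quadForm_conj Φ₂₂ Eᵀ v
    rw [transpose_transpose] at h'
    rw [quadForm_neg, ← h', quadForm, neg_eq_zero]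
    simpa using h
  have h1 := mulVec_eq_zero_of_quadForm_eq_zero h22 h0
  rw [neg_mulVec, neg_eq_zero] at h1
  rw [← mulVec_mulVec, add_mulVec, ← mulVec_mulVec, h1, hker _ h1]
  simp

/-- With `V` the noise matrix, `Lᵀ` maps `(ξ, Z ξ)` to `(ξ, Vᵀ ξ)`. -/
theorem mem_consistentSystems_iff (𝒟 : ISOData n m p T)
    {Φ : Matrix ((Fin n ⊕ Fin p) ⊕ Fin T) ((Fin n ⊕ Fin p) ⊕ Fin T) ℝ} (hΦ : Φ.IsSymm)
    (sys : LinSys n m p) :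
    sys ∈ consistentSystems 𝒟 Φ ↔ sys.toMatrixᵀ ∈ qmiSet (dataMatrix 𝒟 Φ) := by
  rw [mem_qmiSet_iff (isSymm_dataMatrix 𝒟 hΦ)]
  change _ ∈ qmiSet Φ ↔ _
  rw [mem_qmiSet_iff hΦ]
  refine forall_congr' fun ξ => ?_
  have hE : fromRows (-𝒟.Xminus) (-𝒟.U) = -fromRows 𝒟.Xminus 𝒟.U := by
    ext (i | i) j <;> rfl
  simp only [dataMatrix, hE]
  generalize fromRows 𝒟.Xplus 𝒟.Y = W
  generalize fromRows 𝒟.Xminus 𝒟.U = E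
  set L : Matrix ((Fin n ⊕ Fin p) ⊕ (Fin n ⊕ Fin m)) ((Fin n ⊕ Fin p) ⊕ Fin T) ℝ :=
    fromBlocks 1 W 0 (-E) with hL
  have h := quadForm_conj Φ Lᵀ (Sum.elim ξ (sys.toMatrixᵀ *ᵥ ξ))
  rw [transpose_transpose] at h
  rw [h]
  have h2 : Lᵀ *ᵥ Sum.elim ξ (sys.toMatrixᵀ *ᵥ ξ) = Sum.elim ξ ((W - sys.toMatrix * E)ᵀ *ᵥ ξ) := by
    simp [hL, fromBlocks_transpose, fromBlocks_mulVec, add_mulVec, neg_mulVec,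
      sub_eq_add_neg]
  rw [h2]

theorem exists_toMatrix_transpose_eq (Z : Matrix (Fin n ⊕ Fin m) (Fin n ⊕ Fin p) ℝ) :
    ∃ sys : LinSys n m p, sys.toMatrixᵀ = Z := by
  refine ⟨⟨Zᵀ.toBlocks₁₁, Zᵀ.toBlocks₁₂, Zᵀ.toBlocks₂₁, Zᵀ.toBlocks₂₂⟩, ?_⟩
  rw [LinSys.toMatrix, fromBlocks_toBlocks, transpose_transpose]

/-! ### Primal and dual dissipation inequalities -/

/-- The matrix `diag(P, -P, S)`, whose quadratic form at `(x(t), x(t+1), u(t), y(t))` is the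
dissipation. -/
noncomputable def dissipationForm (S : Matrix (Fin m ⊕ Fin p) (Fin m ⊕ Fin p) ℝ)
    (P : Matrix (Fin n) (Fin n) ℝ) :
    Matrix ((Fin n ⊕ Fin n) ⊕ (Fin m ⊕ Fin p)) ((Fin n ⊕ Fin n) ⊕ (Fin m ⊕ Fin p)) ℝ :=
  fromBlocks (fromBlocks P 0 0 (-P)) 0 0 S

theorem isSymm_dissipationForm {S : Matrix (Fin m ⊕ Fin p) (Fin m ⊕ Fin p) ℝ} (hS : S.IsSymm)
    {P : Matrix (Fin n) (Fin n) ℝ} (hP : P.IsSymm) : (dissipationForm S P).IsSymm := by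
  simp [dissipationForm, IsSymm, fromBlocks_transpose, hS.eq, hP.eq]

theorem quadForm_dissipationForm (S : Matrix (Fin m ⊕ Fin p) (Fin m ⊕ Fin p) ℝ)
    (P : Matrix (Fin n) (Fin n) ℝ) (x x' : Fin n → ℝ) (z : Fin m ⊕ Fin p → ℝ) :
    quadForm (dissipationForm S P) (Sum.elim (Sum.elim x x') z) =
      quadForm P x - quadForm P x' + quadForm S z := by
  rw [dissipationForm, quadForm_fromBlocks_diag, quadForm_fromBlocks_diag, quadForm_neg]
  ring

theorem dissipationForm_mul_dissipationForm_inv {S : Matrix (Fin m ⊕ Fin p) (Fin m ⊕ Fin p) ℝ}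
    (hS : IsUnit S.det) {P : Matrix (Fin n) (Fin n) ℝ} (hP : IsUnit P.det) :
    dissipationForm S P * dissipationForm S⁻¹ P⁻¹ = 1 := by
  simp [dissipationForm, fromBlocks_multiply, mul_nonsing_inv _ hS, mul_nonsing_inv _ hP]

namespace LinSys

variable (sys : LinSys n m p)

/-- The vector `(x, A x + B u, u, C x + D u)`. -/
noncomputable def graphMap :
    (Fin n ⊕ Fin m → ℝ) →ₗ[ℝ] ((Fin n ⊕ Fin n) ⊕ (Fin m ⊕ Fin p) → ℝ) :=
  (fromRows (fromBlocks 1 0 sys.A sys.B) (fromBlocks 0 1 sys.C sys.D)).mulVecLin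

/-- The vector `(Aᵀ ξ + Cᵀ η, -ξ, Bᵀ ξ + Dᵀ η, -η)`. -/
noncomputable def dualGraphMap :
    (Fin n ⊕ Fin p → ℝ) →ₗ[ℝ] ((Fin n ⊕ Fin n) ⊕ (Fin m ⊕ Fin p) → ℝ) :=
  (fromRows (fromBlocks sys.Aᵀ sys.Cᵀ (-1) 0) (fromBlocks sys.Bᵀ sys.Dᵀ 0 (-1))).mulVecLin

theorem graphMap_elim (x : Fin n → ℝ) (u : Fin m → ℝ) :
    sys.graphMap (Sum.elim x u) = Sum.elim (Sum.elim x (sys.A *ᵥ x + sys.B *ᵥ u))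
      (Sum.elim u (sys.C *ᵥ x + sys.D *ᵥ u)) := by
  simp [graphMap, fromRows_mulVec, fromBlocks_mulVec]

theorem dualGraphMap_elim (ξ : Fin n → ℝ) (η : Fin p → ℝ) :
    sys.dualGraphMap (Sum.elim ξ η) = Sum.elim (Sum.elim (sys.Aᵀ *ᵥ ξ + sys.Cᵀ *ᵥ η) (-ξ))
      (Sum.elim (sys.Bᵀ *ᵥ ξ + sys.Dᵀ *ᵥ η) (-η)) := by
  simp [dualGraphMap, fromRows_mulVec, fromBlocks_mulVec, neg_mulVec]

theorem graphMap_injective (z : Fin n ⊕ Fin m → ℝ) (hz : sys.graphMap z = 0) : z = 0 := by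
  obtain ⟨x, u, rfl⟩ : ∃ x u, z = Sum.elim x u :=
    ⟨z ∘ Sum.inl, z ∘ Sum.inr, (Sum.elim_comp_inl_inr z).symm⟩
  rw [graphMap_elim] at hz
  ext (i | i)
  · exact congrFun hz (Sum.inl (Sum.inl i))
  · exact congrFun hz (Sum.inr (Sum.inl i))

theorem dualGraphMap_injective (z : Fin n ⊕ Fin p → ℝ) (hz : sys.dualGraphMap z = 0) : z = 0 := by
  obtain ⟨x, u, rfl⟩ : ∃ x u, z = Sum.elim x u :=
    ⟨z ∘ Sum.inl, z ∘ Sum.inr, (Sum.elim_comp_inl_inr z).symm⟩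
  rw [dualGraphMap_elim] at hz
  ext (i | i)
  · exact neg_eq_zero.1 (congrFun hz (Sum.inl (Sum.inr i)))
  · exact neg_eq_zero.1 (congrFun hz (Sum.inr (Sum.inr i)))

/-- By injectivity the two ranges have complementary dimensions `n + m` and `n + p`, so each is the
orthogonal complement of the other. -/
theorem graphMap_dotProduct_dualGraphMap (z : Fin n ⊕ Fin m → ℝ) (w : Fin n ⊕ Fin p → ℝ) :
    sys.graphMap z ⬝ᵥ sys.dualGraphMap w = 0 := by
  obtain ⟨x, u, rfl⟩ : ∃ x u, z = Sum.elim x u :=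
    ⟨z ∘ Sum.inl, z ∘ Sum.inr, (Sum.elim_comp_inl_inr z).symm⟩
  obtain ⟨ξ, η, rfl⟩ : ∃ x u, w = Sum.elim x u :=
    ⟨w ∘ Sum.inl, w ∘ Sum.inr, (Sum.elim_comp_inl_inr w).symm⟩
  have key : ∀ {a b : ℕ} (M : Matrix (Fin a) (Fin b) ℝ) (s : Fin b → ℝ) (t : Fin a → ℝ),
      s ⬝ᵥ (Mᵀ *ᵥ t) = (M *ᵥ s) ⬝ᵥ t := by
    intro a b M s t
    rw [dotProduct_mulVec, vecMul_transpose]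
  simp only [graphMap_elim, dualGraphMap_elim, sumElim_dotProduct_sumElim, dotProduct_add,
    add_dotProduct, dotProduct_neg, key]
  ring

theorem quadForm_dissipationMatrix (S : Matrix (Fin m ⊕ Fin p) (Fin m ⊕ Fin p) ℝ)
    (P : Matrix (Fin n) (Fin n) ℝ) (z : Fin n ⊕ Fin m → ℝ) :
    quadForm (sys.dissipationMatrix S P) z = quadForm (dissipationForm S P) (sys.graphMap z) := by
  simp only [dissipationMatrix]
  rw [quadForm_add, quadForm_conj, quadForm_conj, graphMap, mulVecLin_apply, fromRows_mulVec,
    dissipationForm, quadForm_fromBlocks_diag]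

theorem posSemidef_dissipationMatrix_iff {S : Matrix (Fin m ⊕ Fin p) (Fin m ⊕ Fin p) ℝ}
    (hS : S.IsSymm) {P : Matrix (Fin n) (Fin n) ℝ} (hP : P.IsSymm) :
    (sys.dissipationMatrix S P).PosSemidef ↔
      ∀ z, 0 ≤ quadForm (dissipationForm S P) (sys.graphMap z) := by
  have hsymm : (sys.dissipationMatrix S P).IsSymm := by
    simp only [dissipationMatrix]
    refine IsSymm.add (isSymm_transpose_mul_mul_same ?_ _) (isSymm_transpose_mul_mul_same hS _)
    simp [IsSymm, fromBlocks_transpose, hP.eq]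
  simp only [posSemidef_iff_quadForm, and_iff_right hsymm, quadForm_dissipationMatrix]

theorem isStorage_of_posSemidef {S : Matrix (Fin m ⊕ Fin p) (Fin m ⊕ Fin p) ℝ}
    {P : Matrix (Fin n) (Fin n) ℝ} (hP : P.PosSemidef)
    (h : ∀ z, 0 ≤ quadForm (dissipationForm S P) (sys.graphMap z)) :
    sys.IsStorage S P := by
  refine ⟨hP, fun u x y htraj t => ?_⟩
  have h1 := h (Sum.elim (x t) (u t))
  rw [graphMap_elim, ← (htraj t).1, ← (htraj t).2, quadForm_dissipationForm] at h1
  simp only [quadForm] at h1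
  simp only [supplyRate]
  linarith

end LinSys

theorem isSymm_dualMatrix {S : Matrix (Fin m ⊕ Fin p) (Fin m ⊕ Fin p) ℝ} (hS : S.IsSymm)
    {Q : Matrix (Fin n) (Fin n) ℝ} (hQ : Q.IsSymm) : (dualMatrix S Q).IsSymm := by
  have hSi : (-S⁻¹).IsSymm := by
    rw [IsSymm, transpose_neg, transpose_nonsing_inv, hS.eq]
  rw [← fromBlocks_toBlocks (-S⁻¹), isSymm_fromBlocks_iff] at hSi
  simp [dualMatrix, IsSymm, fromBlocks_transpose, hQ.eq, hSi.1.eq, hSi.2.2.2.eq]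

/-- `dualMatrix` is `-diag(Q, -Q, S⁻¹)` with its coordinates regrouped. The sign of `-η` in the dual
graph turns `Ĝ` into `-Ĝ`. -/
theorem quadForm_dualMatrix {S : Matrix (Fin m ⊕ Fin p) (Fin m ⊕ Fin p) ℝ} (hS : S.IsSymm)
    (Q : Matrix (Fin n) (Fin n) ℝ) (sys : LinSys n m p) (w : Fin n ⊕ Fin p → ℝ) :
    quadForm (dualMatrix S Q) (Sum.elim w (sys.toMatrixᵀ *ᵥ w)) =
      -quadForm (dissipationForm S⁻¹ Q) (sys.dualGraphMap w) := by
  obtain ⟨ξ, η, rfl⟩ : ∃ x u, w = Sum.elim x u :=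
    ⟨w ∘ Sum.inl, w ∘ Sum.inr, (Sum.elim_comp_inl_inr w).symm⟩
  have hSi : (-S⁻¹).IsSymm := by
    rw [IsSymm, transpose_neg, transpose_nonsing_inv, hS.eq]
  rw [LinSys.dualGraphMap_elim, quadForm_dissipationForm, LinSys.toMatrix, fromBlocks_transpose,
    fromBlocks_mulVec, Sum.elim_comp_inl, Sum.elim_comp_inr]
  generalize sys.Aᵀ *ᵥ ξ + sys.Cᵀ *ᵥ η = a
  generalize sys.Bᵀ *ᵥ ξ + sys.Dᵀ *ᵥ η = b
  rw [neg_add, ← quadForm_neg S⁻¹]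
  simp only [dualMatrix]
  generalize -S⁻¹ = R at hSi
  obtain ⟨F, G, G', H, rfl⟩ : ∃ a b c d, R = fromBlocks a b c d :=
    ⟨_, _, _, _, (fromBlocks_toBlocks R).symm⟩
  obtain ⟨-, rfl, -, -⟩ := isSymm_fromBlocks_iff.1 hSi
  simp [quadForm, fromBlocks_mulVec, neg_mulVec, mulVec_neg, dotProduct_add]
  ring

end Data

/-! ### Common storage functions -/

section Main

variable {n m p T : ℕ}

theorem quadForm_add_quadForm_mulVec_pos {k : ℕ} {κ : Type*} [Fintype κ] {R : Matrix (Fin n) (Fin n) ℝ}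
    {M : Matrix κ κ ℝ} {K : Matrix κ (Fin k) ℝ} (hR : ∀ x, x ≠ 0 → 0 < quadForm R x)
    (hK : ∀ c, c ≠ 0 → 0 < quadForm M (K *ᵥ c)) (c : Fin n ⊕ Fin k → ℝ) (hc : c ≠ 0) :
    0 < quadForm R (c ∘ Sum.inl) + quadForm M (K *ᵥ (c ∘ Sum.inr)) := by
  by_cases h1 : c ∘ Sum.inl = 0
  · have h2 : c ∘ Sum.inr ≠ 0 := by
      intro h2
      exact hc (by rw [← Sum.elim_comp_inl_inr c, h1, h2]; ext (i | i) <;> rfl)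
    simpa [h1] using hK _ h2
  · have h2 := hR _ h1
    by_cases h3 : c ∘ Sum.inr = 0
    · simpa [h3] using h2
    · exact add_pos h2 (hK _ h3)

/-- The second state copy, where the form is `-P`, joined to a negative subspace of `S`. -/
theorem exists_dissipationForm_neg {S : Matrix (Fin m ⊕ Fin p) (Fin m ⊕ Fin p) ℝ}
    {k : ℕ} {K : Matrix (Fin m ⊕ Fin p) (Fin k) ℝ}
    (hK : ∀ c, c ≠ 0 → quadForm S (K *ᵥ c) < 0) {P : Matrix (Fin n) (Fin n) ℝ} (hP : P.PosDef) :
    ∃ K' : Matrix ((Fin n ⊕ Fin n) ⊕ (Fin m ⊕ Fin p)) (Fin n ⊕ Fin k) ℝ,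
      ∀ c, c ≠ 0 → quadForm (dissipationForm S P) (K' *ᵥ c) < 0 := by
  refine ⟨fromBlocks (fromRows 0 1) 0 0 K, fun c hc => ?_⟩
  have h := quadForm_add_quadForm_mulVec_pos (M := -S) (K := K) (posDef_iff_quadForm.1 hP).2
    (fun c hc => by simpa using hK c hc) c hc
  have h0 : ((fromRows 0 1 : Matrix (Fin n ⊕ Fin n) (Fin n) ℝ) *ᵥ (c ∘ Sum.inl)) =
      Sum.elim (0 : Fin n → ℝ) (c ∘ Sum.inl) := by
    simp [fromRows_mulVec]
  rw [fromBlocks_mulVec, zero_mulVec, zero_mulVec, add_zero, zero_add, h0,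
    quadForm_dissipationForm, quadForm_zero]
  rw [quadForm_neg] at h
  linarith

/-- The first state copy joined to the image under `S` of a positive subspace of `S`; `S⁻¹` at `S z`
has the value of `S` at `z`. -/
theorem exists_neg_dissipationForm_inv_neg {S : Matrix (Fin m ⊕ Fin p) (Fin m ⊕ Fin p) ℝ}
    (hS : S.IsSymm) (hSu : IsUnit S.det)
    {k : ℕ} {K : Matrix (Fin m ⊕ Fin p) (Fin k) ℝ}
    (hK : ∀ c, c ≠ 0 → 0 < quadForm S (K *ᵥ c)) {Q : Matrix (Fin n) (Fin n) ℝ} (hQ : Q.PosDef) :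
    ∃ K' : Matrix ((Fin n ⊕ Fin n) ⊕ (Fin m ⊕ Fin p)) (Fin n ⊕ Fin k) ℝ,
      ∀ c, c ≠ 0 → quadForm (-dissipationForm S⁻¹ Q) (K' *ᵥ c) < 0 := by
  refine ⟨fromBlocks (fromRows 1 0) 0 0 (S * K), fun c hc => ?_⟩
  have hSK : ∀ c, quadForm S⁻¹ ((S * K) *ᵥ c) = quadForm S (K *ᵥ c) := by
    intro c
    rw [← mulVec_mulVec, ← quadForm_conj, hS.eq, mul_nonsing_inv _ hSu, Matrix.one_mul]
  have h := quadForm_add_quadForm_mulVec_pos (posDef_iff_quadForm.1 hQ).2 hK c hc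
  have h0 : ((fromRows 1 0 : Matrix (Fin n ⊕ Fin n) (Fin n) ℝ) *ᵥ (c ∘ Sum.inl)) =
      Sum.elim (c ∘ Sum.inl) (0 : Fin n → ℝ) := by
    simp [fromRows_mulVec]
  rw [fromBlocks_mulVec, zero_mulVec, zero_mulVec, add_zero, zero_add, h0, quadForm_neg,
    quadForm_dissipationForm, quadForm_zero, hSK]
  linarith

/-- The dissipation inequality is equivalent to the dual one. -/
theorem LinSys.posSemidef_dissipationMatrix_iff_mem_qmiSet (sys : LinSys n m p)
    {S : Matrix (Fin m ⊕ Fin p) (Fin m ⊕ Fin p) ℝ} (hS : S.IsSymm) (hIn : inertia S = (p, 0, m))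
    {P : Matrix (Fin n) (Fin n) ℝ} (hP : P.PosDef) :
    (sys.dissipationMatrix S P).PosSemidef ↔ sys.toMatrixᵀ ∈ qmiSet (dualMatrix S P⁻¹) := by
  have hPs := (posDef_iff_quadForm.1 hP).1
  have hPis := (posDef_iff_quadForm.1 hP.inv).1
  have hSu := isUnit_det_of_inertia hIn
  have hPu := (isUnit_iff_isUnit_det P).1 hP.isUnit
  have hmul := dissipationForm_mul_dissipationForm_inv hSu hPu
  have hSi : S⁻¹.IsSymm := by
    rw [IsSymm, transpose_nonsing_inv, hS.eq]
  rw [sys.posSemidef_dissipationMatrix_iff hS hPs, mem_qmiSet_iff (isSymm_dualMatrix hS hPis)]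
  simp only [quadForm_dualMatrix hS, neg_nonneg]
  constructor
  · intro h w
    obtain ⟨K, hK⟩ := exists_matrix_quadForm_neg hS hIn
    obtain ⟨K', hK'⟩ := exists_dissipationForm_neg hK hP
    exact quadForm_inv_nonpos_of_orthogonal (isSymm_dissipationForm hS hPs) hmul hK' sys.graphMap
      sys.graphMap_injective h (by simp; omega) fun a => sys.graphMap_dotProduct_dualGraphMap a w
  · intro h z
    obtain ⟨K, hK⟩ := exists_matrix_quadForm_pos hS hIn
    obtain ⟨K', hK'⟩ := exists_neg_dissipationForm_inv_neg hS hSu hK hP.inv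
    -- The same dualization with graph and dual graph exchanged, for `-Ψ⁻¹` and its inverse `-Ψ`.
    have := quadForm_inv_nonpos_of_orthogonal (Θ := -dissipationForm S P)
      (isSymm_dissipationForm hSi hPis).neg (by rw [neg_mul_neg]; exact mul_eq_one_comm.1 hmul)
      hK' sys.dualGraphMap sys.dualGraphMap_injective
      (fun a => by rw [quadForm_neg]; exact neg_nonneg.2 (h a)) (by simp; omega)
      (w := sys.graphMap z) fun a => by
        rw [dotProduct_comm]
        exact sys.graphMap_dotProduct_dualGraphMap z a
    simpa using this

/-- For every nonzero state `x` there is a consistent system with `C x ≠ 0`. -/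
theorem exists_mem_consistentSystems_mulVec_ne_zero (hp : 0 < p) (𝒟 : ISOData n m p T)
    {Φ : Matrix ((Fin n ⊕ Fin p) ⊕ Fin T) ((Fin n ⊕ Fin p) ⊕ Fin T) ℝ}
    (hΦ : Φ ∈ PiClass (Fin n ⊕ Fin p) (Fin T))
    (hN : (schurCompl (dataMatrix 𝒟 Φ)).PosDef) {x : Fin n → ℝ} (hx : x ≠ 0) :
    ∃ sys ∈ consistentSystems 𝒟 Φ, sys.C *ᵥ x ≠ 0 := by
  have hNs := isSymm_dataMatrix 𝒟 hΦ.1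
  have hker := ker_dataMatrix 𝒟 hΦ
  obtain ⟨K, hK⟩ := exists_quadForm_eq_schurCompl_add hNs hker
  -- The first entry of `C x` is `v ⬝ᵥ (Z *ᵥ e)`, so it suffices to prescribe an admissible value of
  -- `Z *ᵥ e` not orthogonal to `v`.
  set e : Fin n ⊕ Fin p → ℝ := Sum.elim 0 (Pi.single ⟨0, hp⟩ 1) with he
  set v : Fin n ⊕ Fin m → ℝ := Sum.elim x 0 with hv
  have he0 : e ≠ 0 := by
    intro h
    simpa [he] using congrFun h (Sum.inr ⟨0, hp⟩)
  have hvv : 0 < v ⬝ᵥ v := by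
    rw [hv, sumElim_dotProduct_sumElim]
    simpa using dotProduct_star_self_pos_iff.2 hx
  set s := quadForm (schurCompl (dataMatrix 𝒟 Φ)) e with hs
  have hspos : 0 < s := (posDef_iff_quadForm.1 hN).2 e he0
  set k := quadForm (dataMatrix 𝒟 Φ).toBlocks₂₂ v with hk
  -- The `N`-value at `(e, ε v - K e)` is `s + ε² k`. The center `ε = 0` works unless `K e` is
  -- orthogonal to `v`; then any small `ε > 0` does.
  obtain ⟨ε, hε, hne⟩ : ∃ ε : ℝ, 0 ≤ s + ε ^ 2 * k ∧ v ⬝ᵥ (ε • v - K *ᵥ e) ≠ 0 := by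
    by_cases h0 : v ⬝ᵥ (K *ᵥ e) = 0
    · refine ⟨√(s / (|k| + 1)), ?_, ?_⟩
      · rw [Real.sq_sqrt (by positivity), div_mul_eq_mul_div, ← neg_le_iff_add_nonneg',
          le_div_iff₀ (by positivity)]
        nlinarith [neg_abs_le k]
      · rw [dotProduct_sub, h0, dotProduct_smul, sub_zero, smul_eq_mul]
        positivity
    · exact ⟨0, by simpa using hspos.le, by simpa using h0⟩
  obtain ⟨Z, hZ, hZe⟩ := exists_mem_qmiSet_mulVec_eq hNs hker hN he0 (y := ε • v - K *ᵥ e)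
    (by rwa [hK, sub_add_cancel, quadForm_smul])
  obtain ⟨sys, rfl⟩ := exists_toMatrix_transpose_eq Z
  refine ⟨sys, (mem_consistentSystems_iff 𝒟 hΦ.1 sys).2 hZ, fun h => hne ?_⟩
  rw [← hZe, dotProduct_mulVec, vecMul_transpose, LinSys.toMatrix, fromBlocks_mulVec]
  simp [hv, he, h]

/-- A common storage function for the systems consistent with the data is positive definite. -/
theorem posDef_of_forall_posSemidef_dissipationMatrix (hp : 0 < p) (𝒟 : ISOData n m p T)
    {Φ : Matrix ((Fin n ⊕ Fin p) ⊕ Fin T) ((Fin n ⊕ Fin p) ⊕ Fin T) ℝ}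
    (hΦ : Φ ∈ PiClass (Fin n ⊕ Fin p) (Fin T))
    (hN : (schurCompl (dataMatrix 𝒟 Φ)).PosDef)
    {S : Matrix (Fin m ⊕ Fin p) (Fin m ⊕ Fin p) ℝ} (hS : S.IsSymm) (hIn : inertia S = (p, 0, m))
    {P : Matrix (Fin n) (Fin n) ℝ} (hP : P.PosSemidef)
    (h : ∀ sys ∈ consistentSystems 𝒟 Φ, (sys.dissipationMatrix S P).PosSemidef) : P.PosDef := by
  obtain ⟨hPs, hPn⟩ := posSemidef_iff_quadForm.1 hP
  refine posDef_iff_quadForm.2 ⟨hPs, fun x hx => (hPn x).lt_of_ne' fun hPx => ?_⟩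
  obtain ⟨sys, hsys, hCx⟩ := exists_mem_consistentSystems_mulVec_ne_zero hp 𝒟 hΦ hN hx
  have hdis := (sys.posSemidef_dissipationMatrix_iff hS hPs).1 (h sys hsys)
  obtain ⟨K, hK⟩ := exists_matrix_quadForm_neg hS hIn
  -- `R` sends `(u, τ)` to `(u, τ C x + D u)`. The state `τ x` stores nothing, so the supply there
  -- is nonnegative. Dimension then gives a nonzero kernel vector of `R`, whereas `C x ≠ 0` makes
  -- `R` injective.
  set R : Matrix (Fin m ⊕ Fin p) (Fin m ⊕ Unit) ℝ :=
    fromBlocks 1 0 sys.D (replicateCol Unit (sys.C *ᵥ x)) with hR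
  have hRa : ∀ a, R *ᵥ a = Sum.elim (a ∘ Sum.inl)
      (sys.C *ᵥ (a (Sum.inr ()) • x) + sys.D *ᵥ (a ∘ Sum.inl)) := by
    intro a
    rw [hR, fromBlocks_mulVec, one_mulVec, zero_mulVec, add_zero, add_comm, mulVec_smul]
    congr 2
    ext i
    simp [mulVec, dotProduct, mul_comm]
  obtain ⟨a, ha, hRa0⟩ := exists_ne_zero_map_eq_zero hK R.mulVecLin
    (by
      intro a
      have h1 := hdis (Sum.elim (a (Sum.inr ()) • x) (a ∘ Sum.inl))
      rw [sys.graphMap_elim, quadForm_dissipationForm, quadForm_smul, hPx] at h1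
      rw [mulVecLin_apply, hRa]
      linarith [hPn (sys.A *ᵥ (a (Sum.inr ()) • x) + sys.B *ᵥ (a ∘ Sum.inl))])
    (by simp [add_right_comm])
  rw [mulVecLin_apply, hRa] at hRa0
  have h1 : a ∘ Sum.inl = 0 := funext fun i => congrFun hRa0 (Sum.inl i)
  have h2 : a (Sum.inr ()) • (sys.C *ᵥ x) = 0 := by
    funext i
    have := congrFun hRa0 (Sum.inr i)
    rw [h1, mulVec_zero, add_zero, mulVec_smul] at this
    exact this
  have h3 := (smul_eq_zero.1 h2).resolve_right hCx
  refine ha (funext ?_)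
  rintro (i | i)
  · exact congrFun h1 i
  · exact h3

end Main

end DataDissipativity
open DataDissipativity

/-! ### Informativity as a linear matrix inequality -/

theorem mainTheorem3 (n m p T : ℕ) (hp : 0 < p)
    (𝒟 : ISOData n m p T)
    (Φ : Matrix ((Fin n ⊕ Fin p) ⊕ Fin T) ((Fin n ⊕ Fin p) ⊕ Fin T) ℝ)
    (hΦ : Φ ∈ PiClass (Fin n ⊕ Fin p) (Fin T))
    (S : Matrix (Fin m ⊕ Fin p) (Fin m ⊕ Fin p) ℝ) (hS : S.IsSymm)
    (hIn : inertia S = (p, 0, m))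
    (hN : (schurCompl (dataMatrix 𝒟 Φ)).PosDef) :
    (InformativeForDissipativity 𝒟 Φ S ↔
      ∃ (Q : Matrix (Fin n) (Fin n) ℝ) (α : ℝ), Q.PosDef ∧ 0 ≤ α ∧
        (dualMatrix S Q - α • dataMatrix 𝒟 Φ).PosSemidef) ∧
    (∀ (Q : Matrix (Fin n) (Fin n) ℝ) (α : ℝ), Q.PosDef → 0 ≤ α →
      (dualMatrix S Q - α • dataMatrix 𝒟 Φ).PosSemidef →
      ∀ sys ∈ consistentSystems 𝒟 Φ, sys.IsStorage S Q⁻¹) := by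
  have hNs := isSymm_dataMatrix 𝒟 hΦ.1
  have key : ∀ (Q : Matrix (Fin n) (Fin n) ℝ) (α : ℝ), Q.PosDef → 0 ≤ α →
      (dualMatrix S Q - α • dataMatrix 𝒟 Φ).PosSemidef →
      ∀ sys ∈ consistentSystems 𝒟 Φ, (sys.dissipationMatrix S Q⁻¹).PosSemidef := by
    intro Q α hQ hα hle sys hsys
    rw [mem_consistentSystems_iff 𝒟 hΦ.1, mem_qmiSet_iff hNs] at hsys
    rw [sys.posSemidef_dissipationMatrix_iff_mem_qmiSet hS hIn hQ.inv,
      nonsing_inv_nonsing_inv _ ((isUnit_iff_isUnit_det Q).1 hQ.isUnit),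
      mem_qmiSet_iff (isSymm_dualMatrix hS (posDef_iff_quadForm.1 hQ).1)]
    intro ξ
    have h := (posSemidef_iff_quadForm.1 hle).2 (Sum.elim ξ (sys.toMatrixᵀ *ᵥ ξ))
    rw [quadForm_sub_smul] at h
    linarith [mul_nonneg hα (hsys ξ)]
  refine ⟨⟨?_, ?_⟩, ?_⟩
  · rintro ⟨P, hP, h⟩
    have hPd := posDef_of_forall_posSemidef_dissipationMatrix hp 𝒟 hΦ hN hS hIn hP h
    have : Nonempty (Fin n ⊕ Fin p) := ⟨Sum.inr ⟨0, hp⟩⟩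
    obtain ⟨α, hα, hle⟩ := exists_sub_smul_posSemidef_of_qmiSet_subset
      (isSymm_dualMatrix hS (posDef_iff_quadForm.1 hPd.inv).1) hNs (ker_dataMatrix 𝒟 hΦ) hN (by
        intro Z hZ
        obtain ⟨sys, rfl⟩ := exists_toMatrix_transpose_eq Z
        exact (sys.posSemidef_dissipationMatrix_iff_mem_qmiSet hS hIn hPd).1
          (h sys ((mem_consistentSystems_iff 𝒟 hΦ.1 sys).2 hZ)))
    exact ⟨P⁻¹, α, hPd.inv, hα, hle⟩
  · rintro ⟨Q, α, hQ, hα, hle⟩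
    exact ⟨Q⁻¹, hQ.inv.posSemidef, key Q α hQ hα hle⟩
  · intro Q α hQ hα hle sys hsys
    exact sys.isStorage_of_posSemidef hQ.inv.posSemidef
      ((sys.posSemidef_dissipationMatrix_iff hS (posDef_iff_quadForm.1 hQ.inv).1).1
        (key Q α hQ hα hle sys hsys))
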